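/- Let $K$ be a field, $A=K[X_1,\dots,X_n]$ the standard graded polynomial ring with homogeneous maximal ideal $\mathfrak m=(X_1,\dots,X_n)$, and $F=\bigoplus_{j=1}^m A e_j$ a graded free $A$-module whose basis elements $e_j$ have degrees $d_j\in\mathbb Z$. Let $\omega\in\mathbb Z_{\ge 0}^n$ and $\epsilon\in\mathbb Z_{\ge 0}^m$, and give the monomial $X^u e_j$ of $F$ the weight $\omega\cdot u+\epsilon_j$. For $0\ne f\in F$ let $\operatorname{in}_{(\omega,\epsilon)}(f)$ be the sum of the terms of $f$ of largest weight, and for a submodule $M\subseteq F$ let $\operatorname{in}_{(\omega,\epsilon)}(M)$ be the submodule of $F$ generated by all $\operatorname{in}_{(\omega,\epsilon)}(f)$, $0\neq f\in M$. For a finitely generated graded $A$-module $N$ and $b\in\mathbb Z$ let $N_{\langle b\rangle}$ be the submodule generated by the graded component $N_b$. Let $\operatorname{reg}(N)$ denote the Castelnuovo–Mumford regularity, i.e. the infimum of all $r\in\mathbb Z$ such that the $i$-th module in the minimal graded free resolution of $N$ is generated in degrees $\le r+i$ for all $i\ge 0$, and let the componentwise regularity $\operatorname{creg}(N)$ be the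 infimum of all $r\in\mathbb Z$ such that $\operatorname{reg}(N_{\langle b\rangle})\le b+r$ for all $b\in\mathbb Z$ (so $\operatorname{reg}(0)=\operatorname{creg}(0)=-\infty$). **Theorem (Crystallization).** Let $M\subseteq F$ be a finitely generated graded submodule generated in degrees $\le a$, where $a\in\mathbb Z$. Suppose that $\operatorname{in}_{(\omega,\epsilon)}(M)$ has no minimal generators in degree $b$ (that is, $(\operatorname{in}_{(\omega,\epsilon)}(M)/\mathfrak m\operatorname{in}_{(\omega,\epsilon)}(M))_b=0$) for every integer $b$ with $a+1\le b\le a+1+\operatorname{creg}(\operatorname{in}_{(\omega,\epsilon)}(M))$. Then $\operatorname{in}_{(\omega,\epsilon)}(M)$ is generated in degrees $\le a$. -/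

import Mathlib

/-!
Conventions. `A = K[X_1, …, X_n]` is `MvPolynomial (Fin n) K` with its standard grading, and the
graded free module `F = A(-d_1) ⊕ ⋯ ⊕ A(-d_m)` is `Fin m → A` together with the degrees
`d : Fin m → ℤ` of its standard basis.
-/

noncomputable section

namespace Crystallization

open MvPolynomial

variable {K : Type*} [Field K] {n m m' : ℕ}

/-- The free module `A^m` over `A = K[X_1, …, X_n]`. -/
abbrev Free (K : Type*) [Field K] (n m : ℕ) : Type _ := Fin m → MvPolynomial (Fin n) K

/-- The homogeneous maximal ideal `(X_1, …, X_n)` of `A`. -/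
def irrelevant (K : Type*) [Field K] (n : ℕ) : Ideal (MvPolynomial (Fin n) K) :=
  Ideal.span (Set.range X)

/-- `f` is homogeneous of degree `δ` in `⊕ A(-d_j)`: each monomial `X^u e_j` in the support of `f`
has degree `|u| + d_j = δ`. The zero element is homogeneous of every degree. -/
def IsHomog (d : Fin m → ℤ) (δ : ℤ) (f : Free K n m) : Prop :=
  ∀ j, ∀ u ∈ (f j).support, (u.degree : ℤ) + d j = δ

/-- A submodule of `⊕ A(-d_j)` is graded if it is generated by its homogeneous elements. -/
def IsGraded (d : Fin m → ℤ) (N : Submodule (MvPolynomial (Fin n) K) (Free K n m)) : Prop :=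
  N = Submodule.span _ {f | f ∈ N ∧ ∃ δ, IsHomog d δ f}

/-- `N` is generated by homogeneous elements of degrees at most `a`. -/
def GeneratedInDegreesLE (d : Fin m → ℤ) (a : ℤ)
    (N : Submodule (MvPolynomial (Fin n) K) (Free K n m)) : Prop :=
  N = Submodule.span _ {f | f ∈ N ∧ ∃ δ ≤ a, IsHomog d δ f}

/-- `N` has a minimal generator of degree `b`, that is, `(N / 𝔪 N)_b ≠ 0`. -/
def HasMinimalGenerator (d : Fin m → ℤ) (b : ℤ)
    (N : Submodule (MvPolynomial (Fin n) K) (Free K n m)) : Prop :=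
  ∃ f ∈ N, IsHomog d b f ∧ f ∉ irrelevant K n • N

/-- `N_⟨b⟩`, the submodule of `N` generated by the graded component `N_b`. -/
def component (d : Fin m → ℤ) (b : ℤ) (N : Submodule (MvPolynomial (Fin n) K) (Free K n m)) :
    Submodule (MvPolynomial (Fin n) K) (Free K n m) :=
  Submodule.span _ {f | f ∈ N ∧ IsHomog d b f}

/-! ### Initial modules with respect to weights -/

/-- The weight `ω · u + ε_j` of the monomial `X^u e_j`. -/
def monomialWeight (ω : Fin n → ℕ) (ε : Fin m → ℕ) (u : Fin n →₀ ℕ) (j : Fin m) : ℕ :=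
  (∑ i, ω i * u i) + ε j

/-- The largest weight of a monomial in the support of `f` (and `0` for `f = 0`). -/
def topWeight (ω : Fin n → ℕ) (ε : Fin m → ℕ) (f : Free K n m) : ℕ :=
  Finset.univ.sup fun j => (f j).support.sup fun u => monomialWeight ω ε u j

/-- The initial part of `f`: the sum of the terms of `f` of largest weight. -/
def initialPart (ω : Fin n → ℕ) (ε : Fin m → ℕ) (f : Free K n m) : Free K n m :=
  fun j => ∑ u ∈ (f j).support with monomialWeight ω ε u j = topWeight ω ε f,
    monomial u (coeff u (f j))

/-- The initial module of `M`, generated by the initial parts of all elements of `M`. -/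
def initialModule (ω : Fin n → ℕ) (ε : Fin m → ℕ)
    (M : Submodule (MvPolynomial (Fin n) K) (Free K n m)) :
    Submodule (MvPolynomial (Fin n) K) (Free K n m) :=
  Submodule.span _ (initialPart ω ε '' (M : Set (Free K n m)))

/-! ### Castelnuovo-Mumford regularity and componentwise regularity -/

/-- A homomorphism of graded free modules of degree zero. -/
def IsGradedHom (d : Fin m → ℤ) (d' : Fin m' → ℤ)
    (φ : Free K n m →ₗ[MvPolynomial (Fin n) K] Free K n m') : Prop :=
  ∀ δ f, IsHomog d δ f → IsHomog d' δ (φ f)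

/-- A minimal graded free resolution `⋯ → F_2 → F_1 → F_0 → N → 0` of a graded submodule `N` of
`⊕ A(-d_j)`, where `F_i` has a homogeneous basis of `rank i` elements with degrees `deg i`. -/
structure MinimalResolution (d : Fin m → ℤ)
    (N : Submodule (MvPolynomial (Fin n) K) (Free K n m)) where
  /-- The rank of `F_i`. -/
  rank : ℕ → ℕ
  /-- The degrees of the basis elements of `F_i`. -/
  deg : ∀ i, Fin (rank i) → ℤ
  /-- The map `F_0 → N`, as a map into the ambient free module. -/
  aug : Free K n (rank 0) →ₗ[MvPolynomial (Fin n) K] Free K n m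
  /-- The differential `F_{i+1} → F_i`. -/
  diff : ∀ i, Free K n (rank (i + 1)) →ₗ[MvPolynomial (Fin n) K] Free K n (rank i)
  graded_aug : IsGradedHom (deg 0) d aug
  graded_diff : ∀ i, IsGradedHom (deg (i + 1)) (deg i) (diff i)
  range_aug : LinearMap.range aug = N
  exact_zero : LinearMap.range (diff 0) = LinearMap.ker aug
  exact_succ : ∀ i, LinearMap.range (diff (i + 1)) = LinearMap.ker (diff i)
  minimal : ∀ i, LinearMap.range (diff i) ≤ irrelevant K n • ⊤

/-- `N` is `r`-regular: it has a minimal graded free resolution whose `i`-th module is generated in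
degrees at most `r + i`, for all `i`. -/
def IsRegular (d : Fin m → ℤ) (r : ℤ)
    (N : Submodule (MvPolynomial (Fin n) K) (Free K n m)) : Prop :=
  ∃ R : MinimalResolution d N, ∀ i k, R.deg i k ≤ r + i

/-- The Castelnuovo-Mumford regularity of `N`, the least `r` such that `N` is `r`-regular
(`-∞` for `N = 0`). -/
def reg (d : Fin m → ℤ) (N : Submodule (MvPolynomial (Fin n) K) (Free K n m)) : EReal :=
  sInf {x | ∃ r : ℤ, x = ((r : ℝ) : EReal) ∧ IsRegular d r N}

/-- `N` is `r`-componentwise regular: `reg N_⟨b⟩ ≤ b + r` for all `b`. -/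
def IsComponentwiseRegular (d : Fin m → ℤ) (r : ℤ)
    (N : Submodule (MvPolynomial (Fin n) K) (Free K n m)) : Prop :=
  ∀ b : ℤ, reg d (component d b N) ≤ (((b + r : ℤ) : ℝ) : EReal)

/-- The componentwise regularity of `N`, the infimum of all integers `r` such that `N` is
`r`-componentwise regular (`-∞` for `N = 0`). -/
def creg (d : Fin m → ℤ) (N : Submodule (MvPolynomial (Fin n) K) (Free K n m)) : EReal :=
  sInf {x | ∃ r : ℤ, x = ((r : ℝ) : EReal) ∧ IsComponentwiseRegular d r N}

end Crystallization

end

/-! The proof is Buchberger's criterion, with regularity bounding the degrees in which syzygies must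
be tested. Write I for the initial module. Finitely many elements g_k of M, homogeneous of degree a,
have leading parts generating I_⟨a⟩. Let φ and ψ send e_k to g_k and to its leading part.

If I_⟨a⟩ is (a + r)-regular, then ker ψ is generated in degrees from a to max a (a + 1 + r)
(`IsRegular.ker_le`). There I has no minimal generators above degree a, so it agrees with I_⟨a⟩
(`mem_component_of_not_hasMinimalGenerator`), and division by the g_k leaves no remainder
(`exists_standard_representation`). So every syzygy of the leading parts lifts: cancelling leading
terms in a representation can be traded for terms of smaller weight (`exists_lower_representation`).
An element of M of degree at least a is a combination of the g_k, because M is generated in degrees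
at most a; trading repeatedly makes the weight of the combination equal to that of the element,
whose leading part then lies in the range of ψ (`mem_range_of_syzygies`).

Leading parts are encoded by a bound `Below` on the weight together with the part `bipart` at the
bound, which may vanish; zero elements then need no separate treatment. -/

noncomputable section

namespace Crystallization

open MvPolynomial

/-! ### Gradings of free modules by an abelian group -/

section Grading

variable {K : Type*} [Field K] {n m l : ℕ} {Γ : Type*} [AddCommGroup Γ]

/-- All monomials `X^u e_j` in the support of `f` have degree in `Q`, where `X_i` has degree
`wt i` and `e_j` has degree `e j`. -/
def SuppIn (wt : Fin n → Γ) (e : Fin m → Γ) (Q : Set Γ) (f : Free K n m) : Prop :=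
  ∀ j u, coeff u (f j) ≠ 0 → Finsupp.weight wt u + e j ∈ Q

/-- The homogeneous part of degree `γ`, where `X_i` has degree `wt i` and `e_j` has
degree `e j`. -/
def part (wt : Fin n → Γ) (e : Fin m → Γ) (γ : Γ) : Free K n m →ₗ[K] Free K n m :=
  LinearMap.pi fun j => weightedHomogeneousComponent wt (γ - e j) ∘ₗ LinearMap.proj j

variable {wt : Fin n → Γ} {e : Fin m → Γ} {e' : Fin l → Γ} {Q R : Set Γ} {γ : Γ}
  {f g : Free K n m}

theorem coeff_part [DecidableEq Γ] (j : Fin m) (u : Fin n →₀ ℕ) :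
    coeff u (part wt e γ f j) = if Finsupp.weight wt u + e j = γ then coeff u (f j) else 0 := by
  simp only [part, LinearMap.pi_apply, LinearMap.comp_apply, LinearMap.proj_apply,
    coeff_weightedHomogeneousComponent, eq_sub_iff_add_eq]

theorem SuppIn.zero : SuppIn wt e Q (0 : Free K n m) := fun j u h => by simp at h

theorem SuppIn.add (hf : SuppIn wt e Q f) (hg : SuppIn wt e Q g) : SuppIn wt e Q (f + g) := by
  intro j u h
  by_cases h1 : coeff u (f j) = 0
  · exact hg j u fun h2 => h (by simp [h1, h2])
  · exact hf j u h1

theorem SuppIn.neg (hf : SuppIn wt e Q f) : SuppIn wt e Q (-f) :=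
  fun j u h => hf j u fun h2 => h (by simp [h2])

theorem SuppIn.sub (hf : SuppIn wt e Q f) (hg : SuppIn wt e Q g) : SuppIn wt e Q (f - g) :=
  sub_eq_add_neg f g ▸ hf.add hg.neg

theorem SuppIn.sum {ι : Type*} {s : Finset ι} {F : ι → Free K n m}
    (h : ∀ i ∈ s, SuppIn wt e Q (F i)) : SuppIn wt e Q (∑ i ∈ s, F i) :=
  Finset.sum_induction _ _ (fun _ _ => SuppIn.add) SuppIn.zero h

theorem SuppIn.mono (hQ : Q ⊆ R) (hf : SuppIn wt e Q f) : SuppIn wt e R f :=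
  fun j u h => hQ (hf j u h)

theorem SuppIn.eq_zero (hf : SuppIn wt e ∅ f) : f = 0 := by
  funext j
  ext u
  by_contra h
  exact hf j u h

theorem SuppIn.smul {p : MvPolynomial (Fin n) K} (hf : SuppIn wt e Q f)
    (h : ∀ u, coeff u p ≠ 0 → ∀ β ∈ Q, Finsupp.weight wt u + β ∈ R) : SuppIn wt e R (p • f) := by
  intro j u hu
  rw [Pi.smul_apply, smul_eq_mul, coeff_mul] at hu
  obtain ⟨⟨v, w⟩, hvw, hne⟩ := Finset.exists_ne_zero_of_sum_ne_zero hu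
  rw [Finset.HasAntidiagonal.mem_antidiagonal] at hvw
  have := h v (left_ne_zero_of_mul hne) _ (hf j w (right_ne_zero_of_mul hne))
  rwa [← hvw, map_add, add_assoc]

theorem suppIn_part : SuppIn wt e {γ} (part wt e γ f) := by
  intro j u h
  classical
  rw [coeff_part] at h
  by_contra h'
  exact h (if_neg h')

theorem suppIn_part_of_suppIn (hf : SuppIn wt e Q f) : SuppIn wt e Q (part wt e γ f) := by
  intro j u h
  classical
  rw [coeff_part] at h
  exact hf j u fun h2 => h (by simp [h2])

theorem suppIn_sub_part : SuppIn wt e {γ}ᶜ (f - part wt e γ f) := by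
  intro j u h h'
  classical
  rw [Pi.sub_apply, coeff_sub, coeff_part, if_pos (Set.mem_singleton_iff.1 h'), sub_self] at h
  exact h rfl

theorem SuppIn.part_eq_self (hf : SuppIn wt e {γ} f) : part wt e γ f = f := by
  funext j
  ext u
  classical
  rw [coeff_part]
  split_ifs with h
  · rfl
  · by_contra h'
    exact h (hf j u (Ne.symm h'))

theorem SuppIn.part_eq_zero (hf : SuppIn wt e Q f) (h : γ ∉ Q) : part wt e γ f = 0 := by
  funext j
  ext u
  classical
  rw [coeff_part]
  split_ifs with h'
  · by_contra h''
    exact h (h' ▸ hf j u h'')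
  · simp

theorem SuppIn.of_part_eq_zero (hf : SuppIn wt e Q f) (h : part wt e γ f = 0) :
    SuppIn wt e (Q \ {γ}) f := by
  intro j u hu
  refine ⟨hf j u hu, fun h' => hu ?_⟩
  classical
  have := coeff_part (wt := wt) (e := e) (γ := γ) (f := f) j u
  rwa [if_pos (Set.mem_singleton_iff.1 h'), h, Pi.zero_apply, coeff_zero, eq_comm] at this

/-- An element is the sum of its homogeneous parts. -/
theorem exists_finset_sum_part (wt : Fin n → Γ) (e : Fin m → Γ) (f : Free K n m) :
    ∃ s : Finset Γ, f = ∑ γ ∈ s, part wt e γ f := by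
  classical
  refine ⟨Finset.univ.biUnion fun j =>
    (f j).support.image fun u => Finsupp.weight wt u + e j, ?_⟩
  funext j
  ext u
  rw [Finset.sum_apply, coeff_sum]
  simp only [coeff_part]
  rw [Finset.sum_ite_eq]
  split_ifs with h
  · rfl
  · by_contra h'
    refine h (Finset.mem_biUnion.2 ⟨j, Finset.mem_univ j, Finset.mem_image.2 ⟨u, ?_, rfl⟩⟩)
    exact mem_support_iff.2 h'

theorem mem_of_part_mem (wt : Fin n → Γ) (e : Fin m → Γ)
    {S : Submodule (MvPolynomial (Fin n) K) (Free K n m)}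
    (h : ∀ γ, part wt e γ f ∈ S) : f ∈ S := by
  obtain ⟨s, hs⟩ := exists_finset_sum_part wt e f
  rw [hs]
  exact S.sum_mem fun γ _ => h γ

theorem part_X_smul (i : Fin n) :
    part wt e γ ((X i : MvPolynomial (Fin n) K) • f : Free K n m) =
      ((X i : MvPolynomial (Fin n) K) • part wt e (γ - wt i) f : Free K n m) := by
  have hX : ∀ u, coeff u (X i : MvPolynomial (Fin n) K) ≠ 0 → Finsupp.weight wt u = wt i := by
    intro u hu
    classical
    rw [coeff_X] at hu
    have : Finsupp.single i 1 = u := by by_contra h; exact hu (if_neg h)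
    rw [← this, Finsupp.weight_single, one_smul]
  have h1 : SuppIn wt e {γ}
      ((X i : MvPolynomial (Fin n) K) • part wt e (γ - wt i) f : Free K n m) :=
    suppIn_part.smul fun u hu β hβ => by
      rw [Set.mem_singleton_iff] at hβ ⊢
      rw [hX u hu, hβ, add_sub_cancel]
  have h2 : SuppIn wt e {γ}ᶜ
      ((X i : MvPolynomial (Fin n) K) • (f - part wt e (γ - wt i) f) : Free K n m) :=
    suppIn_sub_part.smul fun u hu β hβ h => hβ (by
      rw [Set.mem_singleton_iff] at h ⊢
      rw [← h, hX u hu, add_sub_cancel_left])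
  have h3 : ((X i : MvPolynomial (Fin n) K) • f : Free K n m) =
      ((X i : MvPolynomial (Fin n) K) • part wt e (γ - wt i) f : Free K n m) +
      ((X i : MvPolynomial (Fin n) K) • (f - part wt e (γ - wt i) f) : Free K n m) := by
    rw [← smul_add, add_sub_cancel]
  rw [h3, map_add, h1.part_eq_self, h2.part_eq_zero (by simp), add_zero]

/-- Taking parts is only `K`-linear, while submodules are closed under polynomial scalars; this
passes between the two. -/
theorem smul_eq_C_smul (c : K) (f : Free K n m) :
    c • f = ((C c : MvPolynomial (Fin n) K) • f : Free K n m) := by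
  funext j
  simp [MvPolynomial.smul_eq_C_mul]

/-- If a property of homogeneous elements is stable under addition and multiplication by scalars
and variables, then it holds for the homogeneous parts of all elements of the span of `S` as soon
as it holds for the homogeneous parts of the elements of `S`. -/
theorem part_span_induction {S : Set (Free K n m)} {P : Γ → Free K n m → Prop}
    (hzero : ∀ γ, P γ 0) (hadd : ∀ γ x y, P γ x → P γ y → P γ (x + y))
    (hsmul : ∀ γ (c : K) x, P γ x → P γ (c • x))
    (hX : ∀ γ i x, P γ x → P (γ + wt i) ((X i : MvPolynomial (Fin n) K) • x : Free K n m))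
    (hmem : ∀ x ∈ S, ∀ γ, P γ (part wt e γ x)) {y : Free K n m}
    (hy : y ∈ Submodule.span (MvPolynomial (Fin n) K) S) (γ : Γ) : P γ (part wt e γ y) := by
  induction hy using Submodule.span_induction generalizing γ with
  | mem x hx => exact hmem x hx γ
  | zero => rw [map_zero]; exact hzero γ
  | add x y _ _ hx hy => rw [map_add]; exact hadd _ _ _ (hx γ) (hy γ)
  | smul p x _ hx =>
    -- A polynomial coefficient mixes degrees, but a single variable only shifts them, so it is
    -- built up one variable at a time.
    induction p using MvPolynomial.induction_on generalizing γ with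
    | C c => rw [← smul_eq_C_smul, map_smul]; exact hsmul _ _ _ (hx γ)
    | add p q hp hq => rw [add_smul, map_add]; exact hadd _ _ _ (hp γ) (hq γ)
    | mul_X p i hp =>
      rw [mul_comm, mul_smul, part_X_smul]
      simpa using hX _ i _ (hp (γ - wt i))

variable {φ : Free K n l →ₗ[MvPolynomial (Fin n) K] Free K n m}

theorem SuppIn.map {q : Fin l → Set Γ} {h : Free K n l} (hh : SuppIn wt e' R h)
    (hφ : ∀ k, SuppIn wt e (q k) (φ (Pi.single k 1)))
    (hQ : ∀ k α, α + e' k ∈ R → ∀ β ∈ q k, α + β ∈ Q) : SuppIn wt e Q (φ h) := by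
  rw [pi_eq_sum_univ' h, map_sum]
  refine SuppIn.sum fun k _ => ?_
  rw [map_smul]
  exact (hφ k).smul fun u hu β hβ => hQ k _ (hh k u hu) β hβ

/-- A homogeneous homomorphism commutes with taking homogeneous parts. -/
theorem map_part (hφ : ∀ k, SuppIn wt e {e' k} (φ (Pi.single k 1))) (h : Free K n l) :
    φ (part wt e' γ h) = part wt e γ (φ h) := by
  have h1 : SuppIn wt e {γ} (φ (part wt e' γ h)) :=
    suppIn_part.map hφ fun k α hα β hβ => by
      rw [Set.mem_singleton_iff] at *
      rw [hβ, hα]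
  have h2 : SuppIn wt e {γ}ᶜ (φ (h - part wt e' γ h)) :=
    suppIn_sub_part.map hφ fun k α hα β hβ => by
      rw [Set.mem_singleton_iff] at hβ
      rwa [hβ]
  conv_rhs => rw [← add_sub_cancel (part wt e' γ h) h]
  rw [map_add, map_add, h1.part_eq_self, h2.part_eq_zero (by simp), add_zero]

/-- Homogeneous lifting along a homogeneous homomorphism. -/
theorem exists_suppIn_map_eq (hφ : ∀ k, SuppIn wt e {e' k} (φ (Pi.single k 1)))
    (hf : SuppIn wt e {γ} f) (hmem : f ∈ LinearMap.range φ) :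
    ∃ h, SuppIn wt e' {γ} h ∧ φ h = f := by
  obtain ⟨h, rfl⟩ := hmem
  exact ⟨part wt e' γ h, suppIn_part, by rw [map_part hφ, hf.part_eq_self]⟩

end Grading

/-! ### The bigrading by degree and weight -/

section Bigrading

variable {K : Type*} [Field K] {n m l : ℕ}

/-- The bidegrees (degree and weight) of the variables. -/
def varBidegree (ω : Fin n → ℕ) : Fin n → ℤ × ℤ := fun i => (1, (ω i : ℤ))

/-- The bidegrees (degree and weight) of the basis elements. -/
def basisBidegree (d e : Fin m → ℤ) : Fin m → ℤ × ℤ := fun j => (d j, e j)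

/-- `f` is homogeneous of degree `δ` and all its monomials have weight less than `w`. -/
def Below (ω : Fin n → ℕ) (d e : Fin m → ℤ) (δ w : ℤ) (f : Free K n m) : Prop :=
  SuppIn (varBidegree ω) (basisBidegree d e) {p | p.1 = δ ∧ p.2 < w} f

/-- The bihomogeneous part of degree `δ` and weight `w`. -/
def bipart (ω : Fin n → ℕ) (d e : Fin m → ℤ) (δ w : ℤ) : Free K n m →ₗ[K] Free K n m :=
  part (varBidegree ω) (basisBidegree d e) (δ, w)

variable {ω : Fin n → ℕ} {d e : Fin m → ℤ} {d' e' : Fin l → ℤ} {δ w w' : ℤ} {f g : Free K n m}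

theorem weight_varBidegree (ω : Fin n → ℕ) (u : Fin n →₀ ℕ) :
    Finsupp.weight (varBidegree ω) u = ((u.degree : ℤ), ((∑ i, ω i * u i : ℕ) : ℤ)) := by
  rw [Finsupp.weight_apply, Finsupp.sum_fintype _ _ (by simp), Finsupp.degree_eq_sum]
  ext
  · simp [varBidegree, Prod.fst_sum]
  · simp [varBidegree, Prod.snd_sum, mul_comm]

theorem isHomog_iff_suppIn : IsHomog d δ f ↔ SuppIn (fun _ => (1 : ℤ)) d {δ} f := by
  have h : ∀ u : Fin n →₀ ℕ, Finsupp.weight (fun _ => (1 : ℤ)) u = u.degree := fun u => by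
    rw [Finsupp.weight_apply, Finsupp.sum_fintype _ _ (by simp), Finsupp.degree_eq_sum]
    simp
  simp only [IsHomog, SuppIn, h, mem_support_iff, Set.mem_singleton_iff]

theorem isHomog_iff_suppIn_bidegree (ω : Fin n → ℕ) (e : Fin m → ℤ) :
    IsHomog d δ f ↔ SuppIn (varBidegree ω) (basisBidegree d e) {p | p.1 = δ} f := by
  simp only [IsHomog, SuppIn, weight_varBidegree, basisBidegree, mem_support_iff,
    Set.mem_ofPred_eq, Prod.mk_add_mk]

theorem Below.isHomog (h : Below ω d e δ w f) : IsHomog d δ f :=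
  (isHomog_iff_suppIn_bidegree ω e).2 (h.mono fun _ hp => hp.1)

theorem Below.mono (hw : w ≤ w') (h : Below ω d e δ w f) : Below ω d e δ w' f :=
  SuppIn.mono (fun _ hp => ⟨hp.1, hp.2.trans_le hw⟩) h

theorem Below.add (hf : Below ω d e δ w f) (hg : Below ω d e δ w g) : Below ω d e δ w (f + g) :=
  SuppIn.add hf hg

theorem Below.sub (hf : Below ω d e δ w f) (hg : Below ω d e δ w g) : Below ω d e δ w (f - g) :=
  SuppIn.sub hf hg

theorem Below.zero : Below ω d e δ w (0 : Free K n m) := SuppIn.zero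

theorem SuppIn.const_smul {Γ : Type*} [AddCommGroup Γ] {wt : Fin n → Γ} {e : Fin m → Γ}
    {Q : Set Γ} (hf : SuppIn wt e Q f) (c : K) : SuppIn wt e Q (c • f) :=
  fun j u h => hf j u fun h2 => h (by simp [h2])

theorem SuppIn.X_smul {Γ : Type*} [AddCommGroup Γ] {wt : Fin n → Γ} {e : Fin m → Γ}
    {Q R : Set Γ} (hf : SuppIn wt e Q f) (i : Fin n) (h : ∀ β ∈ Q, wt i + β ∈ R) :
    SuppIn wt e R ((X i : MvPolynomial (Fin n) K) • f : Free K n m) := by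
  refine hf.smul fun u hu β hβ => ?_
  classical
  rw [coeff_X] at hu
  have : Finsupp.single i 1 = u := by by_contra h; exact hu (if_neg h)
  rw [← this, Finsupp.weight_single, one_smul]
  exact h β hβ

theorem Below.X_smul (hf : Below ω d e δ w f) (i : Fin n) :
    Below ω d e (δ + 1) (w + ω i) ((X i : MvPolynomial (Fin n) K) • f : Free K n m) :=
  SuppIn.X_smul hf i fun β hβ => by
    simp only [Set.mem_ofPred_eq, varBidegree, Prod.fst_add, Prod.snd_add] at *
    omega

theorem IsHomog.X_smul (hf : IsHomog d δ f) (i : Fin n) :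
    IsHomog d (δ + 1) ((X i : MvPolynomial (Fin n) K) • f : Free K n m) :=
  isHomog_iff_suppIn.2 <| (isHomog_iff_suppIn.1 hf).X_smul i fun β hβ => by
    simp only [Set.mem_singleton_iff] at *
    omega

theorem suppIn_bipart :
    SuppIn (varBidegree ω) (basisBidegree d e) {(δ, w)} (bipart ω d e δ w f) := suppIn_part

theorem below_bipart : Below ω d e δ (w + 1) (bipart ω d e δ w f) :=
  suppIn_bipart.mono (by simp)

theorem isHomog_bipart : IsHomog d δ (bipart ω d e δ w f) := below_bipart.isHomog

theorem IsHomog.bipart_eq_zero {δ' : ℤ} (h : IsHomog d δ f) (hδ : δ' ≠ δ) :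
    bipart ω d e δ' w f = 0 :=
  ((isHomog_iff_suppIn_bidegree ω e).1 h).part_eq_zero hδ

theorem Below.bipart_eq_zero (h : Below ω d e δ w f) : bipart ω d e δ w f = 0 :=
  SuppIn.part_eq_zero h (by simp)

theorem Below.of_bipart_eq_zero (h : Below ω d e δ (w + 1) f) (h0 : bipart ω d e δ w f = 0) :
    Below ω d e δ w f := by
  refine (SuppIn.of_part_eq_zero h h0).mono fun p hp => ⟨hp.1.1, ?_⟩
  refine lt_of_le_of_ne (Int.lt_add_one_iff.1 hp.1.2) fun h => hp.2 ?_
  exact Prod.ext hp.1.1 h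

theorem bipart_X_smul (i : Fin n) :
    bipart ω d e δ w ((X i : MvPolynomial (Fin n) K) • f : Free K n m) =
      ((X i : MvPolynomial (Fin n) K) • bipart ω d e (δ - 1) (w - ω i) f : Free K n m) :=
  part_X_smul i

/-- A homogeneous element lies in `S` if its bihomogeneous parts do. -/
theorem IsHomog.mem_of_bipart_mem (ω : Fin n → ℕ) (e : Fin m → ℤ) (h : IsHomog d δ f)
    {S : Submodule (MvPolynomial (Fin n) K) (Free K n m)}
    (hS : ∀ w, bipart ω d e δ w f ∈ S) : f ∈ S := by
  refine mem_of_part_mem (varBidegree ω) (basisBidegree d e) fun ⟨δ', w⟩ => ?_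
  by_cases hδ : δ' = δ
  · exact hδ ▸ hS w
  · have := h.bipart_eq_zero (ω := ω) (e := e) (w := w) hδ
    rw [bipart] at this
    rw [this]
    exact S.zero_mem

theorem IsHomog.exists_below (ω : Fin n → ℕ) (e : Fin m → ℤ) (h : IsHomog d δ f) :
    ∃ w, Below ω d e δ w f := by
  obtain ⟨s, hs⟩ := exists_finset_sum_part (varBidegree ω) (basisBidegree d e) f
  obtain ⟨b, hb⟩ := (s.image Prod.snd).exists_le
  refine ⟨b + 1, ?_⟩
  rw [hs]
  refine SuppIn.sum fun γ hγ j u hu => ⟨?_, ?_⟩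
  · exact suppIn_part_of_suppIn ((isHomog_iff_suppIn_bidegree ω e).1 h) j u hu
  · rw [suppIn_part j u hu]
    exact Int.lt_add_one_iff.2 (hb _ (Finset.mem_image_of_mem _ hγ))

variable {φ ψ : Free K n l →ₗ[MvPolynomial (Fin n) K] Free K n m}

/-- The case c = 1 is for maps that do not raise weight, such as φ; c = 0 is for maps that strictly
lower it, such as φ minus its leading part. -/
theorem Below.map {c : ℤ} {h : Free K n l} (hh : Below ω d' e' δ (w + 1) h)
    (hφ : ∀ k, Below ω d e (d' k) (e' k + c) (φ (Pi.single k 1))) :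
    Below ω d e δ (w + c) (φ h) := by
  refine SuppIn.map hh hφ fun k α hα β hβ => ?_
  simp only [Set.mem_ofPred_eq, basisBidegree, Prod.fst_add, Prod.snd_add] at *
  omega

/-- If `ψ` is the leading part of `φ`, then the leading part of `φ h` is the value of `ψ` at the
leading part of `h`. -/
theorem bipart_map {h : Free K n l} (hh : Below ω d' e' δ (w + 1) h)
    (hφ : ∀ k, Below ω d e (d' k) (e' k + 1) (φ (Pi.single k 1)))
    (hψ : ∀ k, ψ (Pi.single k 1) = bipart ω d e (d' k) (e' k) (φ (Pi.single k 1))) :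
    bipart ω d e δ w (φ h) = ψ (bipart ω d' e' δ w h) := by
  have h1 : Below ω d e δ (w + 0) ((φ - ψ) h) := hh.map fun k => by
    rw [LinearMap.sub_apply, hψ, add_zero]
    refine Below.of_bipart_eq_zero ((hφ k).sub below_bipart) ?_
    rw [map_sub, sub_eq_zero, eq_comm]
    exact suppIn_bipart.part_eq_self
  rw [add_zero, LinearMap.sub_apply] at h1
  have h2 := h1.bipart_eq_zero
  rw [map_sub, sub_eq_zero] at h2
  rw [h2, eq_comm]
  exact map_part (fun k => by rw [hψ]; exact suppIn_bipart) h

end Bigrading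

/-! ### Bihomogeneous elements of the initial module -/

section Initial

variable {K : Type*} [Field K] {n m : ℕ} {ω : Fin n → ℕ} {d : Fin m → ℤ} {ε : Fin m → ℕ}
  {δ w : ℤ} {f : Free K n m} {M : Submodule (MvPolynomial (Fin n) K) (Free K n m)}

theorem coeff_initialPart (j : Fin m) (u : Fin n →₀ ℕ) :
    coeff u (initialPart ω ε f j) =
      if monomialWeight ω ε u j = topWeight ω ε f then coeff u (f j) else 0 := by
  classical
  simp only [initialPart, coeff_sum, coeff_monomial, Finset.sum_ite_eq', Finset.mem_filter,
    mem_support_iff]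
  split_ifs with h1 h2 h2
  · rfl
  · exact absurd h1.2 h2
  · by_contra h
    exact h1 ⟨Ne.symm h, h2⟩
  · rfl

theorem monomialWeight_le_topWeight {j : Fin m} {u : Fin n →₀ ℕ} (h : coeff u (f j) ≠ 0) :
    monomialWeight ω ε u j ≤ topWeight ω ε f :=
  (Finset.le_sup (f := fun u => monomialWeight ω ε u j) (mem_support_iff.2 h)).trans
    (Finset.le_sup (f := fun j => (f j).support.sup fun u => monomialWeight ω ε u j)
      (Finset.mem_univ j))

theorem bidegree_eq (ω : Fin n → ℕ) (d : Fin m → ℤ) (ε : Fin m → ℕ) (u : Fin n →₀ ℕ) (j : Fin m) :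
    Finsupp.weight (varBidegree ω) u + basisBidegree d (fun j => (ε j : ℤ)) j =
      ((u.degree : ℤ) + d j, (monomialWeight ω ε u j : ℤ)) := by
  rw [weight_varBidegree, basisBidegree, monomialWeight, Prod.mk_add_mk, Nat.cast_add]

/-- Either the part at the bound vanishes, or the bound is attained and the part is the initial part
of f. -/
theorem bipart_mem_initialModule (hf : f ∈ M) (h : Below ω d (fun j => (ε j : ℤ)) δ (w + 1) f) :
    bipart ω d (fun j => (ε j : ℤ)) δ w f ∈ initialModule ω ε M := by
  by_cases h0 : bipart ω d (fun j => (ε j : ℤ)) δ w f = 0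
  · rw [h0]
    exact Submodule.zero_mem _
  have hle : ∀ j u, coeff u (f j) ≠ 0 →
      (u.degree : ℤ) + d j = δ ∧ (monomialWeight ω ε u j : ℤ) ≤ w := fun j u hu => by
    have := h j u hu
    rw [bidegree_eq] at this
    exact ⟨this.1, Int.lt_add_one_iff.1 this.2⟩
  obtain ⟨j, hj⟩ := Function.ne_iff.1 h0
  obtain ⟨u, hu⟩ := ne_zero_iff.1 hj
  have hu' := hu
  classical
  rw [bipart, coeff_part, bidegree_eq] at hu'
  obtain ⟨h1, h2⟩ := ite_ne_right_iff.1 hu'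
  have hw : (monomialWeight ω ε u j : ℤ) = w := congrArg Prod.snd h1
  have htop : (topWeight ω ε f : ℤ) = w := by
    rw [← hw, Nat.cast_inj]
    refine le_antisymm (Finset.sup_le fun j' _ => Finset.sup_le fun u' hu' => ?_)
      (monomialWeight_le_topWeight h2)
    have := (hle j' u' (mem_support_iff.1 hu')).2
    omega
  have : bipart ω d (fun j => (ε j : ℤ)) δ w f = initialPart ω ε f := by
    funext j
    ext u
    rw [bipart, coeff_part, bidegree_eq, coeff_initialPart]
    by_cases hc : coeff u (f j) = 0
    · simp [hc]
    · refine if_congr ?_ rfl rfl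
      rw [Prod.mk.injEq, ← htop, Nat.cast_inj]
      exact and_iff_right (hle j u hc).1
  rw [this]
  exact Submodule.subset_span ⟨f, hf, rfl⟩

theorem IsGraded.part_mem (hM : IsGraded d M) (hf : f ∈ M) (δ : ℤ) :
    part (fun _ => (1 : ℤ)) d δ f ∈ M := by
  rw [hM] at hf
  refine part_span_induction (P := fun _ x => x ∈ M) (fun _ => M.zero_mem)
    (fun _ _ _ => M.add_mem) (fun _ c x hx => ?_) (fun _ i x hx => M.smul_mem _ hx)
    (fun x hx γ => ?_) hf δ
  · rw [smul_eq_C_smul]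
    exact M.smul_mem _ hx
  · obtain ⟨hxM, δ', hx⟩ := hx
    rw [isHomog_iff_suppIn] at hx
    by_cases h : γ = δ'
    · rw [h, hx.part_eq_self]
      exact hxM
    · rw [hx.part_eq_zero h]
      exact M.zero_mem

/-- Every bihomogeneous part of an element of the initial module is the leading part of a
homogeneous element of `M`. -/
theorem exists_leading_part (hM : IsGraded d M) (hf : f ∈ initialModule ω ε M) (δ w : ℤ) :
    ∃ g ∈ M, Below ω d (fun j => (ε j : ℤ)) δ (w + 1) g ∧
      bipart ω d (fun j => (ε j : ℤ)) δ w g = bipart ω d (fun j => (ε j : ℤ)) δ w f := by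
  -- Fixing degree and weight together makes the property additive: leading parts at the same bound
  -- add, even when they cancel.
  refine part_span_induction (wt := varBidegree ω) (e := basisBidegree d (fun j => (ε j : ℤ)))
    (P := fun γ x => ∃ g ∈ M, Below ω d (fun j => (ε j : ℤ)) γ.1 (γ.2 + 1) g ∧
      bipart ω d (fun j => (ε j : ℤ)) γ.1 γ.2 g = x)
    (fun _ => ⟨0, M.zero_mem, Below.zero, map_zero _⟩) ?_ ?_ ?_ ?_ hf (δ, w)
  · rintro γ _ _ ⟨g, hg, hgB, rfl⟩ ⟨g', hg', hgB', rfl⟩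
    exact ⟨g + g', M.add_mem hg hg', hgB.add hgB', map_add _ _ _⟩
  · rintro γ c _ ⟨g, hg, hgB, rfl⟩
    refine ⟨c • g, ?_, SuppIn.const_smul hgB c, map_smul _ _ _⟩
    rw [smul_eq_C_smul]
    exact M.smul_mem _ hg
  · rintro γ i _ ⟨g, hg, hgB, rfl⟩
    refine ⟨_, M.smul_mem (X i) hg, ?_, ?_⟩
    · refine (hgB.X_smul i).mono ?_
      simp only [varBidegree, Prod.snd_add]
      omega
    · rw [bipart_X_smul]
      simp [varBidegree]
  · rintro _ ⟨g, hg, rfl⟩ ⟨δ, w⟩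
    classical
    by_cases hw : (topWeight ω ε g : ℤ) = w
    -- At the top weight of g the witness is the degree δ part of g, which is in M because M is
    -- graded; at any other weight the initial part contributes nothing.
    · refine ⟨_, hM.part_mem hg δ, fun j u hu => ?_, ?_⟩
      · have h1 := (isHomog_iff_suppIn_bidegree ω (fun j => (ε j : ℤ))).1
          (isHomog_iff_suppIn.2 suppIn_part) j u hu
        refine ⟨h1, ?_⟩
        rw [coeff_part] at hu
        have := monomialWeight_le_topWeight (ω := ω) (ε := ε) (ite_ne_right_iff.1 hu).2
        rw [bidegree_eq]
        simp only
        omega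
      · funext j
        ext u
        simp only [bipart, coeff_part, bidegree_eq, coeff_initialPart, Prod.mk.injEq]
        by_cases h : (u.degree : ℤ) + d j = δ ∧ (monomialWeight ω ε u j : ℤ) = w
        · rw [if_pos h, if_pos h, if_pos, if_pos]
          · omega
          · rw [Finsupp.weight_apply, Finsupp.sum_fintype _ _ (by simp), ← h.1,
              Finsupp.degree_eq_sum]
            simp
        · rw [if_neg h, if_neg h]
    · refine ⟨0, M.zero_mem, Below.zero, ?_⟩
      funext j
      ext u
      simp only [coeff_part, bidegree_eq, coeff_initialPart, Prod.mk.injEq, map_zero,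
        Pi.zero_apply, coeff_zero]
      rw [eq_comm, ite_eq_right_iff]
      rintro ⟨-, h⟩
      rw [if_neg]
      omega

theorem bipart_mem_of_mem_initialModule (hM : IsGraded d M) (hf : f ∈ initialModule ω ε M)
    (δ w : ℤ) : bipart ω d (fun j => (ε j : ℤ)) δ w f ∈ initialModule ω ε M := by
  obtain ⟨g, hg, hgB, h⟩ := exists_leading_part hM hf δ w
  rw [← h]
  exact bipart_mem_initialModule hg hgB

end Initial

/-! ### Standard representations and lifting of syzygies -/

section Standard

variable {K : Type*} [Field K] {n m s : ℕ} {ω : Fin n → ℕ} {d : Fin m → ℤ} {ε : Fin m → ℕ}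
  {a b δ w : ℤ} {e : Fin s → ℤ} {f : Free K n m}
  {M : Submodule (MvPolynomial (Fin n) K) (Free K n m)}
  {φ ψ : Free K n s →ₗ[MvPolynomial (Fin n) K] Free K n m}

/-- The initial module has a component generated by leading parts of finitely many elements
of `M`. -/
theorem exists_leading_generators (ω : Fin n → ℕ) (ε : Fin m → ℕ) (hM : IsGraded d M) (a : ℤ) :
    ∃ (s : ℕ) (e : Fin s → ℤ) (φ ψ : Free K n s →ₗ[MvPolynomial (Fin n) K] Free K n m),
      LinearMap.range φ ≤ M ∧
      (∀ k, Below ω d (fun j => (ε j : ℤ)) a (e k + 1) (φ (Pi.single k 1))) ∧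
      (∀ k, ψ (Pi.single k 1) = bipart ω d (fun j => (ε j : ℤ)) a (e k) (φ (Pi.single k 1))) ∧
      LinearMap.range ψ = component d a (initialModule ω ε M) := by
  let Y : Set (Free K n m) := {y | ∃ (g : Free K n m) (w : ℤ), g ∈ M ∧
    Below ω d (fun j => (ε j : ℤ)) a (w + 1) g ∧ bipart ω d (fun j => (ε j : ℤ)) a w g = y}
  have hY : Submodule.span _ Y = component d a (initialModule ω ε M) := by
    apply le_antisymm
    · refine Submodule.span_le.2 ?_
      rintro _ ⟨g, w, hg, hgB, rfl⟩
      exact Submodule.subset_span ⟨bipart_mem_initialModule hg hgB, isHomog_bipart⟩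
    · refine Submodule.span_le.2 ?_
      rintro f ⟨hf, hfa⟩
      refine hfa.mem_of_bipart_mem ω (fun j => (ε j : ℤ)) fun w => ?_
      obtain ⟨g, hg, hgB, h⟩ := exists_leading_part hM hf a w
      exact Submodule.subset_span ⟨g, w, hg, hgB, h⟩
  -- The finite generating set is chosen inside Y, so that each generator is a leading part; the
  -- bound w of its lift becomes the weight of the basis element e_k.
  obtain ⟨t, htY, ht⟩ := (Submodule.fg_span_iff_fg_span_finset_subset Y).1
    (IsNoetherian.noetherian (Submodule.span (MvPolynomial (Fin n) K) Y))
  have hty : ∀ k : Fin t.card, (t.equivFin.symm k : Free K n m) ∈ Y :=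
    fun k => htY (t.equivFin.symm k).2
  choose g w hg hgB hgy using hty
  refine ⟨t.card, w, Fintype.linearCombination _ g,
    Fintype.linearCombination _ fun k => (t.equivFin.symm k : Free K n m), ?_, ?_, ?_, ?_⟩
  · rw [Fintype.range_linearCombination, Submodule.span_le]
    rintro _ ⟨k, rfl⟩
    exact hg k
  · intro k
    rw [Fintype.linearCombination_apply_single, one_smul]
    exact hgB k
  · intro k
    rw [Fintype.linearCombination_apply_single, Fintype.linearCombination_apply_single, one_smul,
      one_smul]
    exact (hgy k).symm
  · rw [Fintype.range_linearCombination, ← hY, ht]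
    congr 1
    ext y
    constructor
    · rintro ⟨k, rfl⟩
      exact (t.equivFin.symm k).2
    · intro hy
      exact ⟨t.equivFin ⟨y, hy⟩, by simp⟩

/-- Weights in the ambient module are natural numbers, so division terminates. -/
theorem Below.eq_zero (hw : w ≤ 0) (h : Below ω d (fun j => (ε j : ℤ)) δ w f) : f = 0 := by
  refine SuppIn.eq_zero (wt := varBidegree ω) (e := basisBidegree d (fun j => (ε j : ℤ)))
    fun j u hu => ?_
  have := (h j u hu).2
  rw [bidegree_eq] at this
  simp only at this
  omega

/-- In a degree where the initial module is generated by the leading parts of the `φ e_k`, the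
elements of `M` have standard representations in terms of the `φ e_k`. -/
theorem exists_standard_representation (hφM : LinearMap.range φ ≤ M)
    (hφ : ∀ k, Below ω d (fun j => (ε j : ℤ)) a (e k + 1) (φ (Pi.single k 1)))
    (hψ : ∀ k, ψ (Pi.single k 1) = bipart ω d (fun j => (ε j : ℤ)) a (e k) (φ (Pi.single k 1)))
    (hδ : ∀ f ∈ initialModule ω ε M, IsHomog d δ f → f ∈ LinearMap.range ψ)
    (hf : f ∈ M) (h : Below ω d (fun j => (ε j : ℤ)) δ w f) :
    ∃ h, Below ω (fun _ => a) e δ w h ∧ φ h = f := by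
  rcases le_or_gt w 0 with hw | hw
  · rw [h.eq_zero hw]
    exact ⟨0, Below.zero, map_zero _⟩
  lift w to ℕ using hw.le
  clear hw
  induction w generalizing f with
  | zero =>
    rw [h.eq_zero (by simp)]
    exact ⟨0, Below.zero, map_zero _⟩
  | succ k ih =>
    rw [Nat.cast_succ] at h ⊢
    -- Division step: the leading part of f is ψ of some bihomogeneous h₀, and subtracting φ h₀
    -- removes it. The degree stays δ, so only that degree of the initial module matters.
    have hmem := hδ _ (bipart_mem_initialModule hf h) isHomog_bipart
    obtain ⟨h₀, hh₀, hψ₀⟩ := exists_suppIn_map_eq (wt := varBidegree ω)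
      (e := basisBidegree d (fun j => (ε j : ℤ))) (e' := basisBidegree (fun _ => a) e)
      (γ := (δ, (k : ℤ))) (φ := ψ) (fun i => by rw [hψ]; exact suppIn_bipart) suppIn_bipart hmem
    have hB₀ : Below ω (fun _ => a) e δ (k + 1) h₀ := hh₀.mono (by simp)
    have hlead : bipart ω d (fun j => (ε j : ℤ)) δ k (φ h₀) =
        bipart ω d (fun j => (ε j : ℤ)) δ k f := by
      rw [bipart_map hB₀ hφ hψ, ← hψ₀]
      exact congrArg ψ hh₀.part_eq_self
    obtain ⟨h₁, hh₁, hφ₁⟩ := ih (M.sub_mem hf (hφM ⟨h₀, rfl⟩))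
      ((h.sub (hB₀.map hφ)).of_bipart_eq_zero (by rw [map_sub, hlead, sub_self]))
    refine ⟨h₀ + h₁, hB₀.add (hh₁.mono (by omega)), ?_⟩
    rw [map_add, hφ₁, add_sub_cancel]

/-- If the syzygies of the leading parts are generated in degrees with standard representations,
then a representation whose leading terms cancel can be replaced by one of smaller weight. -/
theorem exists_lower_representation (hφM : LinearMap.range φ ≤ M)
    (hφ : ∀ k, Below ω d (fun j => (ε j : ℤ)) a (e k + 1) (φ (Pi.single k 1)))
    (hψ : ∀ k, ψ (Pi.single k 1) = bipart ω d (fun j => (ε j : ℤ)) a (e k) (φ (Pi.single k 1)))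
    (hker : LinearMap.ker ψ ≤ Submodule.span _ {σ | ψ σ = 0 ∧ ∃ c, IsHomog (fun _ => a) c σ ∧
      ∀ f ∈ initialModule ω ε M, IsHomog d c f → f ∈ LinearMap.range ψ})
    {h : Free K n s} (hh : Below ω (fun _ => a) e δ (w + 1) h)
    (hφh : Below ω d (fun j => (ε j : ℤ)) δ w (φ h)) :
    ∃ h', Below ω (fun _ => a) e δ w h' ∧ φ h' = φ h := by
  have hψbi : ∀ k, SuppIn (varBidegree ω) (basisBidegree d (fun j => (ε j : ℤ)))
      {basisBidegree (fun _ => a) e k} (ψ (Pi.single k 1)) :=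
    fun k => by rw [hψ]; exact suppIn_bipart
  -- The weight of φ h is below the bound for h, so the leading part of h is a syzygy of the leading
  -- parts.
  have hsyz : bipart ω (fun _ => a) e δ w h ∈ LinearMap.ker ψ := by
    rw [LinearMap.mem_ker, ← bipart_map hh hφ hψ, hφh.bipart_eq_zero]
  obtain ⟨h', hh', hφ'⟩ := part_span_induction (wt := varBidegree ω)
    (e := basisBidegree (fun _ => a) e)
    (P := fun γ x => ∃ h', Below ω (fun _ => a) e γ.1 γ.2 h' ∧ φ h' = φ x)
    (fun _ => ⟨0, Below.zero, rfl⟩)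
    (by
      rintro γ x y ⟨h₁, hB₁, hφ₁⟩ ⟨h₂, hB₂, hφ₂⟩
      exact ⟨h₁ + h₂, hB₁.add hB₂, by rw [map_add, map_add, hφ₁, hφ₂]⟩)
    (by
      rintro γ c x ⟨h₁, hB₁, hφ₁⟩
      refine ⟨c • h₁, SuppIn.const_smul hB₁ c, ?_⟩
      rw [smul_eq_C_smul, smul_eq_C_smul, map_smul, map_smul, hφ₁])
    (by
      rintro γ i x ⟨h₁, hB₁, hφ₁⟩
      exact ⟨_, hB₁.X_smul i, by rw [map_smul, map_smul, hφ₁]⟩)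
    (by
      rintro σ ⟨hσ, c, hσc, hgood⟩ ⟨δ, w⟩
      by_cases hδ : δ = c
      · subst hδ
        change ∃ h', _ ∧ φ h' = φ (bipart ω (fun _ => a) e δ w σ)
        have hB : Below ω (fun _ => a) e δ (w + 1) (bipart ω (fun _ => a) e δ w σ) := below_bipart
        -- ψ is bihomogeneous, so each bihomogeneous part of σ is again a syzygy. Its image under φ
        -- thus has weight below w, and division represents that image within this smaller weight.
        refine exists_standard_representation hφM hφ hψ hgood (hφM ⟨_, rfl⟩)
          ((hB.map hφ).of_bipart_eq_zero ?_)
        rw [bipart_map hB hφ hψ]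
        have h1 : bipart ω (fun _ => a) e δ w (bipart ω (fun _ => a) e δ w σ) =
          bipart ω (fun _ => a) e δ w σ := suppIn_bipart.part_eq_self
        rw [h1, bipart, map_part hψbi, hσ, map_zero]
      · refine ⟨0, Below.zero, ?_⟩
        have h1 : bipart ω (fun _ => a) e δ w σ = 0 := hσc.bipart_eq_zero hδ
        rw [bipart] at h1
        rw [h1])
    (hker hsyz) (δ, w)
  have h1 : part (varBidegree ω) (basisBidegree (fun _ => a) e) (δ, w)
      (bipart ω (fun _ => a) e δ w h) = bipart ω (fun _ => a) e δ w h :=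
    suppIn_bipart.part_eq_self
  rw [h1] at hφ'
  refine ⟨h - bipart ω (fun _ => a) e δ w h + h', Below.add ?_ hh', ?_⟩
  · refine (hh.sub below_bipart).of_bipart_eq_zero ?_
    rw [map_sub, sub_eq_zero]
    exact h1.symm
  · rw [map_add, map_sub, hφ', sub_add_cancel]

/-- A module generated in degrees at most `a` is generated by its component of degree `a` in
degrees at least `a`. -/
theorem GeneratedInDegreesLE.mem_component (hM : GeneratedInDegreesLE d a M) (hab : a ≤ b)
    (hf : f ∈ M) (hfb : IsHomog d b f) : f ∈ component d a M := by
  rw [hM] at hf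
  have := part_span_induction (wt := fun _ => (1 : ℤ)) (e := d)
    (P := fun b x => x ∈ M ∧ IsHomog d b x ∧ (a ≤ b → x ∈ component d a M))
    (fun _ => ⟨M.zero_mem, isHomog_iff_suppIn.2 SuppIn.zero, fun _ => Submodule.zero_mem _⟩)
    (fun γ x y hx hy => ⟨M.add_mem hx.1 hy.1, isHomog_iff_suppIn.2
      ((isHomog_iff_suppIn.1 hx.2.1).add (isHomog_iff_suppIn.1 hy.2.1)),
      fun h => Submodule.add_mem _ (hx.2.2 h) (hy.2.2 h)⟩)
    (fun γ c x hx => ⟨by rw [smul_eq_C_smul]; exact M.smul_mem _ hx.1,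
      isHomog_iff_suppIn.2 ((isHomog_iff_suppIn.1 hx.2.1).const_smul c),
      fun h => by rw [smul_eq_C_smul]; exact Submodule.smul_mem _ _ (hx.2.2 h)⟩)
    (fun γ i x hx => by
      have hX := M.smul_mem (X i) hx.1
      refine ⟨hX, hx.2.1.X_smul i, fun h => ?_⟩
      by_cases hγ : a ≤ γ
      · exact Submodule.smul_mem _ _ (hx.2.2 hγ)
      -- Here the multiplication by X_i enters degree a from below, and the product is itself an
      -- element of M_a.
      · have : γ + 1 = a := by omega
        exact Submodule.subset_span ⟨hX, this ▸ hx.2.1.X_smul i⟩)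
    (by
      rintro x ⟨hxM, δ, hδ, hx⟩ γ
      have hx' := isHomog_iff_suppIn.1 hx
      by_cases h : γ = δ
      · subst h
        rw [hx'.part_eq_self]
        refine ⟨hxM, hx, fun h => Submodule.subset_span ⟨hxM, ?_⟩⟩
        rwa [le_antisymm h hδ]
      · rw [hx'.part_eq_zero h]
        exact ⟨M.zero_mem, isHomog_iff_suppIn.2 SuppIn.zero, fun _ => Submodule.zero_mem _⟩)
    hf b
  rw [(isHomog_iff_suppIn.1 hfb).part_eq_self] at this
  exact this.2.2 hab

/-- If the syzygies of the leading parts are generated in degrees with standard representations,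
then the initial module is generated in degree `a` by the leading parts. -/
theorem mem_range_of_syzygies (hM : IsGraded d M) (hgen : GeneratedInDegreesLE d a M)
    (hφM : LinearMap.range φ ≤ M)
    (hφ : ∀ k, Below ω d (fun j => (ε j : ℤ)) a (e k + 1) (φ (Pi.single k 1)))
    (hψ : ∀ k, ψ (Pi.single k 1) = bipart ω d (fun j => (ε j : ℤ)) a (e k) (φ (Pi.single k 1)))
    (hψr : LinearMap.range ψ = component d a (initialModule ω ε M))
    (hker : LinearMap.ker ψ ≤ Submodule.span _ {σ | ψ σ = 0 ∧ ∃ c, IsHomog (fun _ => a) c σ ∧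
      ∀ f ∈ initialModule ω ε M, IsHomog d c f → f ∈ LinearMap.range ψ})
    (hab : a ≤ b) (hf : f ∈ initialModule ω ε M) (hfb : IsHomog d b f) :
    f ∈ LinearMap.range ψ := by
  refine hfb.mem_of_bipart_mem ω (fun j => (ε j : ℤ)) fun w => ?_
  obtain ⟨g, hg, hgB, hgf⟩ := exists_leading_part hM hf b w
  rw [← hgf]
  -- In degree a division by the φ e_k succeeds by the choice of ψ.
  have hcomp : component d a M ≤ LinearMap.range φ := by
    refine Submodule.span_le.2 ?_
    rintro x ⟨hx, hxa⟩
    obtain ⟨w, hw⟩ := hxa.exists_below ω (fun j => (ε j : ℤ))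
    obtain ⟨h, -, hh⟩ := exists_standard_representation hφM hφ hψ
      (fun f hf hfa => hψr ▸ Submodule.subset_span ⟨hf, hfa⟩) hx hw
    exact ⟨h, hh⟩
  obtain ⟨h, hh, hφh⟩ := exists_suppIn_map_eq (wt := fun _ => (1 : ℤ)) (e := d)
    (e' := fun _ => a) (fun k => isHomog_iff_suppIn.1 (hφ k).isHomog)
    (isHomog_iff_suppIn.1 hgB.isHomog) (hcomp (hgen.mem_component hab hg hgB.isHomog))
  obtain ⟨w', hw'⟩ := (isHomog_iff_suppIn.2 hh).exists_below ω e
  -- The excess k of the weight of the representation over that of g is lowered one unit at a time.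
  have hdesc : ∀ k : ℕ, ∀ h, Below ω (fun _ => a) e b (w + 1 + k) h → φ h = g →
      ∃ h, Below ω (fun _ => a) e b (w + 1) h ∧ φ h = g := by
    intro k
    induction k with
    | zero => exact fun h hh hφh => ⟨h, by simpa using hh, hφh⟩
    | succ k ih =>
      intro h hh hφh
      obtain ⟨h', hh', hφ'⟩ := exists_lower_representation (w := w + 1 + k) hφM hφ hψ hker
        (hh.mono (by push_cast; omega)) (hφh ▸ hgB.mono (by omega))
      exact ih h' hh' (hφ'.trans hφh)
  obtain ⟨h', hh', rfl⟩ := hdesc (w' - w).toNat h (hw'.mono (by omega)) hφh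
  exact ⟨_, (bipart_map hh' hφ hψ).symm⟩

end Standard

/-! ### Degrees of syzygies -/

section Syzygies

variable {K : Type*} [Field K] {n m m₁ m₂ : ℕ} {d : Fin m → ℤ} {d₁ : Fin m₁ → ℤ}
  {d₂ : Fin m₂ → ℤ} {a b r : ℤ} {f : Free K n m}
  {N : Submodule (MvPolynomial (Fin n) K) (Free K n m)}

theorem isHomog_single (d : Fin m → ℤ) (k : Fin m) :
    IsHomog d (d k) (Pi.single k 1 : Free K n m) := by
  intro j u hu
  classical
  rcases eq_or_ne j k with rfl | h
  · rw [Pi.single_eq_same, mem_support_iff, coeff_one, ite_ne_right_iff] at hu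
    simp [← hu.1]
  · rw [Pi.single_eq_of_ne h] at hu
    simp at hu

theorem isGradedHom_of_single {α : Free K n m₁ →ₗ[MvPolynomial (Fin n) K] Free K n m}
    (h : ∀ k, IsHomog d (d₁ k) (α (Pi.single k 1))) : IsGradedHom d₁ d α := by
  intro δ f hf
  rw [isHomog_iff_suppIn] at hf ⊢
  refine hf.map (fun k => isHomog_iff_suppIn.1 (h k)) fun k x hx β hβ => ?_
  rw [Set.mem_singleton_iff] at *
  rw [hβ, hx]

/-- Graded free modules are projective. -/
theorem IsGradedHom.exists_lift {α : Free K n m₁ →ₗ[MvPolynomial (Fin n) K] Free K n m}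
    {β : Free K n m₂ →ₗ[MvPolynomial (Fin n) K] Free K n m} (hα : IsGradedHom d₁ d α)
    (hβ : IsGradedHom d₂ d β) (h : LinearMap.range α ≤ LinearMap.range β) :
    ∃ γ : Free K n m₁ →ₗ[MvPolynomial (Fin n) K] Free K n m₂,
      IsGradedHom d₁ d₂ γ ∧ ∀ x, β (γ x) = α x := by
  have hlift : ∀ k, ∃ v, SuppIn (fun _ => (1 : ℤ)) d₂ {d₁ k} v ∧ β v = α (Pi.single k 1) :=
    fun k => exists_suppIn_map_eq (e := d)
      (fun i => isHomog_iff_suppIn.1 (hβ _ _ (isHomog_single d₂ i)))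
      (isHomog_iff_suppIn.1 (hα _ _ (isHomog_single d₁ k))) (h ⟨_, rfl⟩)
  choose v hv hβv using hlift
  refine ⟨Fintype.linearCombination _ v, isGradedHom_of_single fun k => ?_, fun x => ?_⟩
  · rw [Fintype.linearCombination_apply_single, one_smul]
    exact isHomog_iff_suppIn.2 (hv k)
  · rw [Fintype.linearCombination_apply, map_sum]
    conv_rhs => rw [pi_eq_sum_univ' x, map_sum]
    simp only [map_smul, hβv]

theorem mem_of_single_mem {α : Free K n m₁ →ₗ[MvPolynomial (Fin n) K] Free K n m}
    (h : ∀ k, α (Pi.single k 1) ∈ N) (x : Free K n m₁) : α x ∈ N := by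
  rw [pi_eq_sum_univ' x, map_sum]
  exact N.sum_mem fun k _ => by rw [map_smul]; exact N.smul_mem _ (h k)

/-- The syzygies of generators of degree `a` of an `(a + r)`-regular module are generated in
degrees at most `max a (a + r + 1)`. -/
theorem IsRegular.ker_le (hN : IsRegular d (a + r) N)
    {ψ : Free K n m₁ →ₗ[MvPolynomial (Fin n) K] Free K n m}
    (hψ : IsGradedHom (fun _ => a) d ψ) (hψr : LinearMap.range ψ = N) :
    LinearMap.ker ψ ≤ Submodule.span _ {σ | ψ σ = 0 ∧ ∃ c, IsHomog (fun _ => a) c σ ∧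
      a ≤ c ∧ c ≤ max a (a + 1 + r)} := by
  obtain ⟨R, hR⟩ := hN
  have hrange : LinearMap.range ψ = LinearMap.range R.aug := hψr.trans R.range_aug.symm
  obtain ⟨α, hα, hα'⟩ := hψ.exists_lift R.graded_aug hrange.le
  obtain ⟨β, hβ, hβ'⟩ := R.graded_aug.exists_lift hψ hrange.ge
  intro h hh
  have hαh : α h ∈ LinearMap.range (R.diff 0) := by
    rw [R.exact_zero, LinearMap.mem_ker, hα']
    exact hh
  obtain ⟨z, hz⟩ := hαh
  -- Comparison with the resolution: α and β are lifts between the two covers of N. The syzygy β (α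
  -- h) comes from the first differential, and h - β (α h) is the correction.
  have h1 : h = (LinearMap.id - β ∘ₗ α : Module.End _ (Free K n m₁)) h + (β ∘ₗ R.diff 0) z := by
    simp [hz]
  rw [h1]
  refine Submodule.add_mem _ (mem_of_single_mem (fun k => ?_) _)
    (mem_of_single_mem (fun k => ?_) _)
  -- The corrections have degree a and record redundancy among the generators; hence the maximum
  -- with a.
  · refine Submodule.subset_span ⟨by simp [hα', hβ'], a, ?_, le_rfl, le_max_left _ _⟩
    rw [isHomog_iff_suppIn]
    exact (isHomog_iff_suppIn.1 (isHomog_single (fun _ => a) k)).sub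
      (isHomog_iff_suppIn.1 (hβ _ _ (hα _ _ (isHomog_single (fun _ => a) k))))
  · have hdeg : IsHomog (fun _ => a) (R.deg 1 k) ((β ∘ₗ R.diff 0) (Pi.single k 1)) :=
      hβ _ _ (R.graded_diff 0 _ _ (isHomog_single _ k))
    have hker : ψ ((β ∘ₗ R.diff 0) (Pi.single k 1)) = 0 := by
      rw [LinearMap.comp_apply, hβ', ← LinearMap.mem_ker, ← R.exact_zero]
      exact ⟨_, rfl⟩
    rcases lt_or_ge (R.deg 1 k) a with hlt | hge
    -- The source of ψ has no nonzero elements in degrees below a.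
    · have : (β ∘ₗ R.diff 0) (Pi.single k 1) = 0 := by
        funext j
        by_contra hne
        obtain ⟨u, hu⟩ := ne_zero_iff.1 hne
        have : (u.degree : ℤ) + a = R.deg 1 k := hdeg j u (mem_support_iff.2 hu)
        omega
      rw [this]
      exact Submodule.zero_mem _
    · refine Submodule.subset_span ⟨hker, _, hdeg, hge, le_max_of_le_right ?_⟩
      have := hR 1 k
      push_cast at this
      omega

end Syzygies

/-! ### Generators of the initial module -/

section Generators

variable {K : Type*} [Field K] {n m : ℕ} {ω : Fin n → ℕ} {d : Fin m → ℤ} {ε : Fin m → ℕ}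
  {a b c r : ℤ} {f : Free K n m} {M S : Submodule (MvPolynomial (Fin n) K) (Free K n m)}

/-- In a degree without minimal generators, the initial module is generated by elements of the
preceding degree. -/
theorem mem_of_not_hasMinimalGenerator (hM : IsGraded d M)
    (hc : ¬ HasMinimalGenerator d c (initialModule ω ε M))
    (hS : ∀ f ∈ initialModule ω ε M, IsHomog d (c - 1) f → f ∈ S)
    (hf : f ∈ initialModule ω ε M) (hfc : IsHomog d c f) : f ∈ S := by
  have hfm : f ∈ irrelevant K n • initialModule ω ε M := by
    by_contra h
    exact hc ⟨f, hf, hfc, h⟩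
  -- Elements in an expression of f in 𝔪 I need not be homogeneous, so the claim is proved for
  -- bihomogeneous parts; multiplication by X_i takes such a part from degree c - 1 to c.
  refine hfc.mem_of_bipart_mem ω (fun j => (ε j : ℤ)) fun w => ?_
  clear hf hfc
  induction hfm using Submodule.smul_induction_on' with
  | smul p hp x hx =>
    unfold irrelevant at hp
    induction hp using Submodule.span_induction generalizing x with
    | mem p hp =>
      obtain ⟨i, rfl⟩ := hp
      rw [bipart_X_smul]
      exact S.smul_mem _ (hS _ (bipart_mem_of_mem_initialModule hM hx _ _) isHomog_bipart)
    | zero => simp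
    | add p q _ _ hp hq => rw [add_smul, map_add]; exact S.add_mem (hp x hx) (hq x hx)
    | smul q p _ hp =>
      rw [smul_eq_mul, mul_comm, mul_smul]
      exact hp _ (Submodule.smul_mem _ _ hx)
  | add x _ y _ hx hy => rw [map_add]; exact S.add_mem hx hy

/-- If the initial module has no minimal generators in degrees `a + 1, …, b`, then it is generated
by its component of degree `a` in these degrees. -/
theorem mem_component_of_not_hasMinimalGenerator (hM : IsGraded d M)
    (hmin : ∀ c, a + 1 ≤ c → c ≤ b → ¬ HasMinimalGenerator d c (initialModule ω ε M))
    (hac : a ≤ c) (hcb : c ≤ max a b) (hf : f ∈ initialModule ω ε M) (hfc : IsHomog d c f) :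
    f ∈ component d a (initialModule ω ε M) := by
  -- If b < a, the bound `max a b` leaves only c = a, which is the base case.
  induction c, hac using Int.leInduction generalizing f with
  | base => exact Submodule.subset_span ⟨hf, hfc⟩
  | succ c hac ih =>
    refine mem_of_not_hasMinimalGenerator hM (hmin (c + 1) (by omega) (by omega))
      (fun f hf hfc => ih (by omega) hf ?_) hf hfc
    simpa using hfc

/-- The initial module contains the bihomogeneous parts of its elements. Those of degree at most a
are admissible generators; the others are covered by the hypothesis. -/
theorem generatedInDegreesLE_of_mem_component (hM : IsGraded d M)
    (h : ∀ b, a ≤ b → ∀ f ∈ initialModule ω ε M, IsHomog d b f →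
      f ∈ component d a (initialModule ω ε M)) :
    GeneratedInDegreesLE d a (initialModule ω ε M) := by
  refine le_antisymm (fun f hf => ?_) (Submodule.span_le.2 fun f hf => hf.1)
  refine mem_of_part_mem (varBidegree ω) (basisBidegree d (fun j => (ε j : ℤ))) fun ⟨b, w⟩ => ?_
  have hmem := bipart_mem_of_mem_initialModule hM hf b w
  have hb : IsHomog d b (bipart ω d (fun j => (ε j : ℤ)) b w f) := isHomog_bipart
  rw [bipart] at hmem hb
  rcases le_total a b with hab | hba
  · refine Submodule.span_mono ?_ (h b hab _ hmem hb)
    exact fun x hx => ⟨hx.1, a, le_rfl, hx.2⟩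
  · exact Submodule.subset_span ⟨hmem, b, hba, hb⟩

/-- The initial module is generated in degrees at most `a` if it has no minimal generators in the
degrees `a + 1, …, a + 1 + r`, where its component of degree `a` is `(a + r)`-regular. -/
theorem generatedInDegreesLE_of_isRegular (hM : IsGraded d M) (hgen : GeneratedInDegreesLE d a M)
    (hreg : IsRegular d (a + r) (component d a (initialModule ω ε M)))
    (hmin : ∀ c, a + 1 ≤ c → c ≤ a + 1 + r → ¬ HasMinimalGenerator d c (initialModule ω ε M)) :
    GeneratedInDegreesLE d a (initialModule ω ε M) := by
  obtain ⟨s, e, φ, ψ, hφM, hφ, hψ, hψr⟩ := exists_leading_generators ω ε hM a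
  refine generatedInDegreesLE_of_mem_component hM fun b hab f hf hfb => ?_
  rw [← hψr]
  refine mem_range_of_syzygies hM hgen hφM hφ hψ hψr ?_ hab hf hfb
  refine (hreg.ker_le (isGradedHom_of_single fun k => ?_) hψr).trans (Submodule.span_mono ?_)
  · rw [hψ]
    exact isHomog_bipart
  · rintro σ ⟨hσ, c, hσc, hac, hcb⟩
    refine ⟨hσ, c, hσc, fun f hf hfc => ?_⟩
    rw [hψr]
    exact mem_component_of_not_hasMinimalGenerator hM hmin hac hcb hf hfc

end Generators

/-! ### Regularity as an infimum -/

section Infimum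

variable {K : Type*} [Field K] {n m : ℕ} {d : Fin m → ℤ} {r r' : ℤ}
  {N : Submodule (MvPolynomial (Fin n) K) (Free K n m)}

/-- No integer lies strictly between r and r + 1, so an element of the set below r + 1 is at most r,
even when the infimum is -∞. -/
theorem of_sInf_int_le {P : ℤ → Prop} (hP : ∀ r r', r ≤ r' → P r → P r')
    (h : sInf {x : EReal | ∃ r : ℤ, x = ((r : ℝ) : EReal) ∧ P r} ≤ ((r : ℝ) : EReal)) : P r := by
  have hlt : ((r : ℝ) : EReal) < (((r + 1 : ℤ) : ℝ) : EReal) := by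
    rw [EReal.coe_lt_coe_iff, Int.cast_lt]
    exact lt_add_one r
  obtain ⟨_, ⟨r', rfl, hr'⟩, hlt'⟩ := sInf_lt_iff.1 (h.trans_lt hlt)
  rw [EReal.coe_lt_coe_iff, Int.cast_lt, Int.lt_add_one_iff] at hlt'
  exact hP _ _ hlt' hr'

theorem isRegular_of_reg_le (h : reg d N ≤ ((r : ℝ) : EReal)) : IsRegular d r N :=
  of_sInf_int_le (P := fun r => IsRegular d r N)
    (fun _ _ hr ⟨R, hR⟩ => ⟨R, fun i k => (hR i k).trans (by omega)⟩) h

theorem isComponentwiseRegular_of_creg_le (h : creg d N ≤ ((r : ℝ) : EReal)) :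
    IsComponentwiseRegular d r N := by
  refine of_sInf_int_le (P := fun r => IsComponentwiseRegular d r N)
    (fun r r' hr h b => (h b).trans ?_) h
  rw [EReal.coe_le_coe_iff, Int.cast_le]
  omega

/-- A finite componentwise regularity is an integer. -/
theorem exists_creg_eq (h : creg d N ≠ ⊤) (h' : creg d N ≠ ⊥) :
    ∃ r : ℤ, creg d N = ((r : ℝ) : EReal) := by
  lift creg d N to ℝ using ⟨h, h'⟩ with x hx
  refine ⟨⌊x⌋, le_antisymm ?_ (EReal.coe_le_coe_iff.2 (Int.floor_le x))⟩
  have hlt : creg d N < (((⌊x⌋ + 1 : ℤ) : ℝ) : EReal) := by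
    rw [← hx, EReal.coe_lt_coe_iff]
    push_cast
    exact Int.lt_floor_add_one x
  obtain ⟨_, ⟨r', rfl, hr'⟩, hlt'⟩ := sInf_lt_iff.1 hlt
  rw [EReal.coe_lt_coe_iff, Int.cast_lt, Int.lt_add_one_iff] at hlt'
  rw [hx]
  refine le_trans (sInf_le ?_ : creg d N ≤ ((r' : ℝ) : EReal)) ?_
  · exact ⟨r', rfl, hr'⟩
  rwa [EReal.coe_le_coe_iff, Int.cast_le]

end Infimum

end Crystallization

end

/-! ### The theorem, according to whether the componentwise regularity is ∞, -∞ or an integer -/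

open Crystallization in
theorem theorem5p2 {K : Type*} [Field K] {n m : ℕ} (d : Fin m → ℤ)
    (ω : Fin n → ℕ) (ε : Fin m → ℕ)
    (M : Submodule (MvPolynomial (Fin n) K) (Fin m → MvPolynomial (Fin n) K))
    (hfg : M.FG) (hgr : IsGraded d M) (a : ℤ) (hgen : GeneratedInDegreesLE d a M)
    (hmin : ∀ b : ℤ, a + 1 ≤ b →
      ((b : ℝ) : EReal) ≤ (((a + 1 : ℤ) : ℝ) : EReal) + creg d (initialModule ω ε M) →
      ¬ HasMinimalGenerator d b (initialModule ω ε M)) :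
    GeneratedInDegreesLE d a (initialModule ω ε M) := by
  by_cases htop : creg d (initialModule ω ε M) = ⊤
  -- Every degree above a is free of minimal generators, so no syzygies are needed.
  · refine generatedInDegreesLE_of_mem_component hgr fun b hab f hf hfb =>
      mem_component_of_not_hasMinimalGenerator (b := b) hgr (fun c hc _ => hmin c hc ?_) hab
        (le_max_right a b) hf hfb
    rw [htop, EReal.coe_add_top]
    exact le_top
  by_cases hbot : creg d (initialModule ω ε M) = ⊥
  -- Every integer bounds -∞; r = -1 makes the range from a + 1 to a + 1 + r empty.
  · have hreg : IsComponentwiseRegular d (-1) (initialModule ω ε M) :=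
      isComponentwiseRegular_of_creg_le (hbot ▸ bot_le)
    exact generatedInDegreesLE_of_isRegular hgr hgen (isRegular_of_reg_le (hreg a))
      fun c hc hc' => by omega
  obtain ⟨r, hr⟩ := exists_creg_eq htop hbot
  refine generatedInDegreesLE_of_isRegular hgr hgen
    (isRegular_of_reg_le (isComponentwiseRegular_of_creg_le hr.le a)) fun c hc hc' => hmin c hc ?_
  rw [hr, ← EReal.coe_add, EReal.coe_le_coe_iff]
  exact_mod_cast hc'
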